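/- Let $G(s)=C(sI-A)^{-1}B+D$ be a continuous-time system with real matrices $A\in\mathbb R^{n\times n}$, $B\in\mathbb R^{n\times m}$, $C\in\mathbb R^{p\times n}$, $D\in\mathbb R^{p\times m}$. Let $\varpi_h>0$, $\rho\in\mathbb R$ and $0\le r\le n$. Write $s_\rho=(\rho^2+\varpi_h^2)^{1/2}$ and $k_\rho=(\rho^2+1)^{1/2}$. *Discrete-time balanced truncation* of a Schur stable system $(\mathbf A,\mathbf B,\mathbf C,\mathbf D)$ to order $r$ means the following. Solve $\mathbf A P\mathbf A^{T}-P+\mathbf B\mathbf B^{T}=0$ and $\mathbf A^{T}Q\mathbf A-Q+\mathbf C^{T}\mathbf C=0$. Factor $P=UU^{T}$ with $U$ square and invertible. Write $U^{T}QU=V\Sigma^2V^{T}$ with $V$ orthogonal and $\Sigma=\mathrm{diag}(\sigma_1,\dots,\sigma_n)$, $\sigma_1\ge\dots\ge\sigma_n>0$. Put $T=\Sigma^{1/2}V^{T}U^{-1}$. Keep the first $r$ states of $(T\mathbf AT^{-1},T\mathbf B,\mathbf CT^{-1},\mathbf D)$. (It is part of the hypothesis that these steps can be carried out, i.e. that $U$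 and $T$ exist and are invertible.) The high-frequency parameterized frequency-dependent balanced truncation algorithm produces a reduced model $G_r=(A_r,B_r,C_r,D_r)$ by one of two routines. * *Routine 1 (upper type).* The mapped system is $\mathbf A=s_\rho^{-1}(\rho I+A)$, $\mathbf B=s_\rho^{-1}B$, $\mathbf C=s_\rho^{-1}C$, $\mathbf D=s_\rho^{-1}D$. The parameter $\rho$ is admissible if $\mathbf A$ is Schur stable. Reduce the mapped system by discrete-time balanced truncation to $(\mathbf A_r,\mathbf B_r,\mathbf C_r,\mathbf D_r)$ and set $A_r=s_\rho\mathbf A_r-\rho I$, $B_r=s_\rho\mathbf B_r$, $C_r=s_\rho\mathbf C_r$, $D_r=s_\rho\mathbf D_r$. * *Routine 2 (lower type).* Put $M=(\varpi_hI-\rho A)^{-1}$. The mapped system is $\mathbf A=k_\rho AM$, $\mathbf B=MB$, $\mathbf C=CM$, $\mathbf D=k_\rho^{-1}\varpi_h^{-1}(\rho\,CMB+D)$. The parameter $\rho$ is admissible if $M$ exists and $\mathbf A$ is Schur stable. Reduce the mapped system by discrete-time balanced truncation to $(\mathbf A_r,\mathbf B_r,\mathbf C_r,\mathbf D_r)$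 and set $A_r=\varpi_hk_\rho^{-1}\mathbf A_r(I+\rho k_\rho^{-1}\mathbf A_r)^{-1}$, $B_r=(\varpi_hI-\rho A_r)\mathbf B_r$, $C_r=\mathbf C_r(\varpi_hI-\rho A_r)$, $D_r=\varpi_hk_\rho\bigl(\mathbf D_r-\rho k_\rho^{-1}\varpi_h^{-1}C_r(\varpi_hI-\rho A_r)^{-1}B_r\bigr)$. Let $\sigma_{h\rho 1}\ge\dots\ge\sigma_{h\rho n}$ be the numbers $\sigma_i$ obtained for the mapped system of the routine used. **Theorem.** If $G_r$ is produced with an admissible $\rho$, then for every real $\omega$ with $|\omega|\ge\varpi_h$ the point $\jmath\omega$ is an eigenvalue of neither $A$ nor $A_r$, and $$\sigma_{\max}\bigl(G(\jmath\omega)-G_r(\jmath\omega)\bigr)\le 2\,(\rho^2+\varpi_h^2)^{1/2}\sum_{i=r+1}^n\sigma_{h\rho i}\qquad\text{for Routine 1},$$ $$\sigma_{\max}\bigl(G(\jmath\omega)-G_r(\jmath\omega)\bigr)\le 2\,\bigl((\varpi_h\rho)^2+\varpi_h^2\bigr)^{1/2}\sum_{i=r+1}^n\sigma_{h\rho i}\qquad\text{for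 Routine 2}.$$ (Routine 2 uses the dimensionless parameter: its bound is that of Routine 1 with $\varpi_h\rho$ in place of $\rho$.) -/

import Mathlib

noncomputable section

namespace PFDBT

open Matrix

/-- A real realization `(A, B, C, D)` of a linear time-invariant system with `n` states,
`m` inputs and `p` outputs. It is read as a continuous-time or as a discrete-time system. -/
structure StateSpace (n m p : ℕ) where
  A : Matrix (Fin n) (Fin n) ℝ
  B : Matrix (Fin n) (Fin m) ℝ
  C : Matrix (Fin p) (Fin n) ℝ
  D : Matrix (Fin p) (Fin m) ℝ

/-- The entrywise inclusion of real matrices into complex matrices. -/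
def toC {k l : ℕ} (M : Matrix (Fin k) (Fin l) ℝ) : Matrix (Fin k) (Fin l) ℂ :=
  M.map Complex.ofReal

namespace StateSpace

variable {n m p : ℕ}

/-- `s` is not an eigenvalue of `A`, so that the transfer function is defined at `s`. -/
def DefinedAt (G : StateSpace n m p) (s : ℂ) : Prop :=
  IsUnit (s • (1 : Matrix (Fin n) (Fin n) ℂ) - toC G.A).det

/-- The transfer function `C (s I - A)⁻¹ B + D`. -/
def transfer (G : StateSpace n m p) (s : ℂ) : Matrix (Fin p) (Fin m) ℂ :=
  toC G.C * (s • (1 : Matrix (Fin n) (Fin n) ℂ) - toC G.A)⁻¹ * toC G.B + toC G.D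

/-- All eigenvalues of `A` lie in the open unit disc. -/
def SchurStable (G : StateSpace n m p) : Prop :=
  ∀ z ∈ spectrum ℂ (toC G.A), ‖z‖ < 1

/-- The realization in the coordinates `x' = T x`. -/
def changeCoord (G : StateSpace n m p) (T : Matrix (Fin n) (Fin n) ℝ) : StateSpace n m p where
  A := T * G.A * T⁻¹
  B := T * G.B
  C := G.C * T⁻¹
  D := G.D

/-- The truncation `(Z A Zᵀ, Z B, C Zᵀ, D)` with `Z = [I 0]`, which keeps the first `r` states. -/
def truncate {r : ℕ} (hr : r ≤ n) (G : StateSpace n m p) : StateSpace r m p where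
  A := G.A.submatrix (Fin.castLE hr) (Fin.castLE hr)
  B := G.B.submatrix (Fin.castLE hr) id
  C := G.C.submatrix id (Fin.castLE hr)
  D := G.D

end StateSpace

/-- The maximum singular value of a complex matrix. -/
def sigmaMax {p m : ℕ} (M : Matrix (Fin p) (Fin m) ℂ) : ℝ :=
  (Matrix.toEuclideanLin M).singularValues 0

/-- The data computed by one run of standard discrete-time Lyapunov balanced truncation on `G`:
the Gramians `P`, `Q`, a square factor `U` of `P`, the orthogonal factor `V` of the eigenvalue
decomposition of `Uᵀ Q U`, and the diagonal `σ` of its middle factor `Σ` (the square roots of the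
eigenvalues of `Uᵀ Q U`, that is, the Hankel singular values), in descending order.
The two conditions `isUnit_U` and `sigma_pos` say that the balancing transformation
`T = Σ^(1/2) Vᵀ U⁻¹` exists and is invertible. -/
structure IsBalancingData {n m p : ℕ} (G : StateSpace n m p)
    (P Q U V : Matrix (Fin n) (Fin n) ℝ) (σ : Fin n → ℝ) : Prop where
  lyap_ctrl : G.A * P * G.Aᵀ - P + G.B * G.Bᵀ = 0
  lyap_obs : G.Aᵀ * Q * G.A - Q + G.Cᵀ * G.C = 0
  factor : P = U * Uᵀ
  isUnit_U : IsUnit U.det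
  orthogonal : V ∈ Matrix.orthogonalGroup (Fin n) ℝ
  eigen : Uᵀ * Q * U = V * Matrix.diagonal (fun i => σ i ^ 2) * Vᵀ
  sigma_pos : ∀ i, 0 < σ i
  sigma_antitone : Antitone σ

/-- The balancing transformation `T = Σ^(1/2) Vᵀ U⁻¹`. -/
def balancingT {n : ℕ} (U V : Matrix (Fin n) (Fin n) ℝ) (σ : Fin n → ℝ) :
    Matrix (Fin n) (Fin n) ℝ :=
  Matrix.diagonal (fun i => √(σ i)) * Vᵀ * U⁻¹

/-- `Gr` is an order-`r` model produced by standard discrete-time Lyapunov balanced truncation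
of `G`, with Hankel singular values `σ`. -/
def IsLyaBT {n m p r : ℕ} (hr : r ≤ n) (G : StateSpace n m p) (σ : Fin n → ℝ)
    (Gr : StateSpace r m p) : Prop :=
  ∃ P Q U V : Matrix (Fin n) (Fin n) ℝ, IsBalancingData G P Q U V σ ∧
    Gr = (G.changeCoord (balancingT U V σ)).truncate hr

variable {n m p : ℕ}

/-- The upper type mapped system for the frequency range `|ω| ≥ w`. -/
def upperMap (w ρ : ℝ) (G : StateSpace n m p) : StateSpace n m p where
  A := (√(ρ ^ 2 + w ^ 2))⁻¹ • (ρ • (1 : Matrix (Fin n) (Fin n) ℝ) + G.A)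
  B := (√(ρ ^ 2 + w ^ 2))⁻¹ • G.B
  C := (√(ρ ^ 2 + w ^ 2))⁻¹ • G.C
  D := (√(ρ ^ 2 + w ^ 2))⁻¹ • G.D

/-- The inverse upper type mapping. -/
def upperInv (w ρ : ℝ) (S : StateSpace n m p) : StateSpace n m p where
  A := √(ρ ^ 2 + w ^ 2) • S.A - ρ • (1 : Matrix (Fin n) (Fin n) ℝ)
  B := √(ρ ^ 2 + w ^ 2) • S.B
  C := √(ρ ^ 2 + w ^ 2) • S.C
  D := √(ρ ^ 2 + w ^ 2) • S.D

/-- The lower type mapped system for the frequency range `|ω| ≥ w`; it is meaningful when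
`w I - ρ A` is invertible. -/
def lowerMap (w ρ : ℝ) (G : StateSpace n m p) : StateSpace n m p where
  A := √(ρ ^ 2 + 1) • (G.A * (w • (1 : Matrix (Fin n) (Fin n) ℝ) - ρ • G.A)⁻¹)
  B := (w • (1 : Matrix (Fin n) (Fin n) ℝ) - ρ • G.A)⁻¹ * G.B
  C := G.C * (w • (1 : Matrix (Fin n) (Fin n) ℝ) - ρ • G.A)⁻¹
  D := ((√(ρ ^ 2 + 1))⁻¹ * w⁻¹ * ρ) •
      (G.C * (w • (1 : Matrix (Fin n) (Fin n) ℝ) - ρ • G.A)⁻¹ * G.B) +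
    ((√(ρ ^ 2 + 1))⁻¹ * w⁻¹) • G.D

/-- The state matrix of the inverse lower type mapping. -/
def lowerInvA (w ρ : ℝ) (S : StateSpace n m p) : Matrix (Fin n) (Fin n) ℝ :=
  (w * (√(ρ ^ 2 + 1))⁻¹) •
    (S.A * ((1 : Matrix (Fin n) (Fin n) ℝ) + (ρ * (√(ρ ^ 2 + 1))⁻¹) • S.A)⁻¹)

/-- The input matrix of the inverse lower type mapping. -/
def lowerInvB (w ρ : ℝ) (S : StateSpace n m p) : Matrix (Fin n) (Fin m) ℝ :=
  (w • (1 : Matrix (Fin n) (Fin n) ℝ) - ρ • lowerInvA w ρ S) * S.B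

/-- The output matrix of the inverse lower type mapping. -/
def lowerInvC (w ρ : ℝ) (S : StateSpace n m p) : Matrix (Fin p) (Fin n) ℝ :=
  S.C * (w • (1 : Matrix (Fin n) (Fin n) ℝ) - ρ • lowerInvA w ρ S)

/-- The inverse lower type mapping. -/
def lowerInv (w ρ : ℝ) (S : StateSpace n m p) : StateSpace n m p where
  A := lowerInvA w ρ S
  B := lowerInvB w ρ S
  C := lowerInvC w ρ S
  D := (w * √(ρ ^ 2 + 1)) • (S.D - (ρ * (√(ρ ^ 2 + 1))⁻¹ * w⁻¹) •
    (lowerInvC w ρ S * (w • (1 : Matrix (Fin n) (Fin n) ℝ) - ρ • lowerInvA w ρ S)⁻¹ *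
      lowerInvB w ρ S))

/-- `Gr` is produced from `G` by the first routine of the high-frequency algorithm: `ρ` is
admissible (the upper type mapped system is Schur stable), the mapped system is reduced to order
`r` by discrete-time balanced truncation, with Hankel singular values `σ`, and the result is mapped
back. -/
def IsUpperReduction {r : ℕ} (hr : r ≤ n) (w ρ : ℝ) (G : StateSpace n m p) (σ : Fin n → ℝ)
    (Gr : StateSpace r m p) : Prop :=
  (upperMap w ρ G).SchurStable ∧
    ∃ S : StateSpace r m p, IsLyaBT hr (upperMap w ρ G) σ S ∧ Gr = upperInv w ρ S

/-- `Gr` is produced from `G` by the second routine of the high-frequency algorithm: `ρ` is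
admissible (the lower type mapped system is well defined and Schur stable), the mapped system is
reduced to order `r` by discrete-time balanced truncation, with Hankel singular values `σ`, and the
result is mapped back. -/
def IsLowerReduction {r : ℕ} (hr : r ≤ n) (w ρ : ℝ) (G : StateSpace n m p) (σ : Fin n → ℝ)
    (Gr : StateSpace r m p) : Prop :=
  IsUnit (w • (1 : Matrix (Fin n) (Fin n) ℝ) - ρ • G.A).det ∧
  (lowerMap w ρ G).SchurStable ∧
    ∃ S : StateSpace r m p, IsLyaBT hr (lowerMap w ρ G) σ S ∧ Gr = lowerInv w ρ S

end PFDBT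

end

/-!
The mappings of both routines are Möbius substitutions. Put `c = √(ρ² + w²)`, `z = (s + ρ) / c` for
the first one and `c = w √(ρ² + 1)`, `z = √(ρ² + 1) s / (w - ρ s)` for the second. Then
`G(s) = c H(z)` for the mapped system `H` (`transfer_eq_upperMap`, `transfer_eq_lowerMap`), the
inverse mapping undoes this for the reduced model (`upperMap_upperInv`, `lowerMap_lowerInv`), and
`|ω| ≥ w` gives `‖z‖ ≥ 1` at `s = jω`. What is needed is therefore the error bound `2 ∑_{i ≥ r} σ i`
of discrete-time balanced truncation on and outside the unit circle.

The balancing transformation makes both Gramians equal to `Σ = diag σ`. For the state `x` at `z` with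
input `u`, this gives an observability identity for `A x`, `C x` in the energy `x* Σ x`, and a
controllability inequality for `A x + B u` in the energy `x* Σ⁻¹ x`. By the first, a truncation has no
eigenvalue on or outside the unit circle, even when equal singular values are separated
(`StateSpace.IsBalanced.truncState_eq_zero`).

States are removed one at a time. Let `x'` and `x` be the states before and after removing the state
`k`, and let `v` be the value which the removed row of the state equation takes at `x`. Then `x' - x`
obeys the state equation with zero input and the disturbance `+v` in row `k`, and `x' + x` obeys it
with input `2u` and the disturbance `-v`. Adding the observability identity for the difference to
`σ k ^ 2` times the controllability inequality for the sum cancels the cross terms in `v` and leaves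
`‖C (x' - x)‖ ≤ 2 σ k ‖u‖` (`StateSpace.IsBalanced.norm_output_sub_le`). Since `‖z‖ ≥ 1` enters the
estimates only through `‖x i‖ ≤ ‖z x i‖`, the argument is pointwise in `z` and needs no maximum principle. The
triangle inequality sums these bounds (`StateSpace.IsBalanced.norm_transfer_sub_truncate_le`).
-/

namespace PFDBT

open Matrix

variable {n m p : ℕ}

/-! ### The maximum singular value -/

theorem sigmaMax_le (M : Matrix (Fin p) (Fin m) ℂ) {c : ℝ} (hc : 0 ≤ c)
    (h : ∀ u : Fin m → ℂ, ‖WithLp.toLp 2 (M *ᵥ u)‖ ≤ c * ‖WithLp.toLp 2 u‖) :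
    sigmaMax M ≤ c := by
  unfold sigmaMax
  set T := Matrix.toEuclideanLin M with hT
  by_cases hn : 0 < Module.finrank ℂ (EuclideanSpace ℂ (Fin m))
  · obtain ⟨v, hv⟩ := (T.hasEigenvalue_adjoint_comp_self_sq_singularValues hn).exists_hasEigenvector
    have hTv : ‖T v‖ ^ 2 = T.singularValues 0 ^ 2 * ‖v‖ ^ 2 := by
      have h1 : inner ℂ (T v) (T v) = inner ℂ v ((LinearMap.adjoint T ∘ₗ T) v) := by
        rw [LinearMap.comp_apply, LinearMap.adjoint_inner_right]
      rw [hv.apply_eq_smul, inner_smul_right, inner_self_eq_norm_sq_to_K,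
        inner_self_eq_norm_sq_to_K] at h1
      exact_mod_cast h1
    have hle : ‖T v‖ ≤ c * ‖v‖ := h v.ofLp
    have hv0 : 0 < ‖v‖ := norm_pos_iff.2 hv.2
    have h2 : (T.singularValues 0 * ‖v‖) ^ 2 ≤ (c * ‖v‖) ^ 2 := by
      rw [mul_pow, ← hTv]
      exact pow_le_pow_left₀ (norm_nonneg _) hle 2
    exact le_of_mul_le_mul_right (le_of_sq_le_sq h2 (by positivity)) hv0
  · rw [T.singularValues_of_finrank_le (not_lt.1 hn)]
    exact hc

/-! ### Energy inequalities for a balanced realization -/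

theorem toC_mulVec_re {k l : ℕ} (M : Matrix (Fin k) (Fin l) ℝ) (x : Fin l → ℂ) (i : Fin k) :
    ((toC M *ᵥ x) i).re = (M *ᵥ fun j => (x j).re) i := by
  simp [toC, mulVec, dotProduct]

theorem toC_mulVec_im {k l : ℕ} (M : Matrix (Fin k) (Fin l) ℝ) (x : Fin l → ℂ) (i : Fin k) :
    ((toC M *ᵥ x) i).im = (M *ᵥ fun j => (x j).im) i := by
  simp [toC, mulVec, dotProduct]

theorem sum_norm_sq_eq_re_add_im {k : ℕ} (w : Fin k → ℝ) (x : Fin k → ℂ) :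
    ∑ i, w i * ‖x i‖ ^ 2 = ∑ i, w i * (x i).re ^ 2 + ∑ i, w i * (x i).im ^ 2 := by
  rw [← Finset.sum_add_distrib]
  refine Finset.sum_congr rfl fun i _ => ?_
  rw [Complex.sq_norm, Complex.normSq_apply]
  ring

/-- A realization is balanced with weights `σ` when both Gramians equal `diag σ`. -/
structure StateSpace.IsBalanced (H : StateSpace n m p) (σ : Fin n → ℝ) : Prop where
  ctrl : H.A * diagonal σ * H.Aᵀ + H.B * H.Bᵀ = diagonal σ
  obs : H.Aᵀ * diagonal σ * H.A + H.Cᵀ * H.C = diagonal σ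

theorem dotProduct_diagonal_mulVec {k : ℕ} (w x : Fin k → ℝ) :
    x ⬝ᵥ (diagonal w *ᵥ x) = ∑ i, w i * x i ^ 2 := by
  simp only [dotProduct, mulVec_diagonal]
  exact Finset.sum_congr rfl fun i _ => by ring

theorem dotProduct_gram_mulVec {k l : ℕ} (M : Matrix (Fin k) (Fin l) ℝ)
    (N : Matrix (Fin k) (Fin k) ℝ) (x : Fin l → ℝ) :
    x ⬝ᵥ ((Mᵀ * N * M) *ᵥ x) = (M *ᵥ x) ⬝ᵥ (N *ᵥ (M *ᵥ x)) := by
  rw [← mulVec_mulVec, ← mulVec_mulVec, dotProduct_mulVec, vecMul_transpose]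

theorem StateSpace.IsBalanced.obs_real {H : StateSpace n m p} {σ : Fin n → ℝ}
    (hH : H.IsBalanced σ) (x : Fin n → ℝ) :
    ∑ i, σ i * (H.A *ᵥ x) i ^ 2 + ∑ j, (H.C *ᵥ x) j ^ 2 = ∑ i, σ i * x i ^ 2 := by
  have h := congrArg (fun N => x ⬝ᵥ (N *ᵥ x)) hH.obs
  have h1 : H.Cᵀ * H.C = H.Cᵀ * diagonal (fun _ : Fin p => (1 : ℝ)) * H.C := by simp
  simp only [add_mulVec, dotProduct_add] at h
  rw [h1, dotProduct_gram_mulVec, dotProduct_gram_mulVec] at h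
  simpa only [dotProduct_diagonal_mulVec, one_mul] using h

theorem StateSpace.IsBalanced.ctrl_dual {H : StateSpace n m p} {σ : Fin n → ℝ}
    (hH : H.IsBalanced σ) (x : Fin n → ℝ) :
    ∑ i, σ i * (H.Aᵀ *ᵥ x) i ^ 2 + ∑ j, (H.Bᵀ *ᵥ x) j ^ 2 = ∑ i, σ i * x i ^ 2 :=
  StateSpace.IsBalanced.obs_real (H := ⟨H.Aᵀ, H.Cᵀ, H.Bᵀ, H.Dᵀ⟩)
    ⟨by simpa using hH.obs, by simpa using hH.ctrl⟩ x

/-- With `q = A x + B u` and `y = Σ⁻¹ q`, the energy `qᵀ Σ⁻¹ q` is `(Aᵀ y)ᵀ x + (Bᵀ y)ᵀ u`; each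
product is bounded by Young's inequality and the dual terms are collected by the controllability
Gramian equation. -/
theorem StateSpace.IsBalanced.ctrl_real {H : StateSpace n m p} {σ : Fin n → ℝ}
    (hH : H.IsBalanced σ) (hσ : ∀ i, 0 < σ i) (x : Fin n → ℝ) (u : Fin m → ℝ) :
    ∑ i, (σ i)⁻¹ * (H.A *ᵥ x + H.B *ᵥ u) i ^ 2 ≤ ∑ i, (σ i)⁻¹ * x i ^ 2 + ∑ j, u j ^ 2 := by
  set q := H.A *ᵥ x + H.B *ᵥ u with hq
  set y : Fin n → ℝ := fun i => (σ i)⁻¹ * q i with hy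
  have h1 : ∑ i, (σ i)⁻¹ * q i ^ 2 = y ⬝ᵥ q :=
    Finset.sum_congr rfl fun i _ => by simp only [hy]; ring
  have h2 : y ⬝ᵥ q = (H.Aᵀ *ᵥ y) ⬝ᵥ x + (H.Bᵀ *ᵥ y) ⬝ᵥ u := by
    rw [hq, dotProduct_add, dotProduct_mulVec, dotProduct_mulVec, mulVec_transpose,
      mulVec_transpose]
  have h3 : ∑ i, σ i * y i ^ 2 = y ⬝ᵥ q :=
    Finset.sum_congr rfl fun i _ => by
      have := (hσ i).ne'
      simp only [hy]; field_simp
  have h4 : 2 * ((H.Aᵀ *ᵥ y) ⬝ᵥ x) ≤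
      ∑ i, σ i * (H.Aᵀ *ᵥ y) i ^ 2 + ∑ i, (σ i)⁻¹ * x i ^ 2 := by
    rw [dotProduct, Finset.mul_sum, ← Finset.sum_add_distrib]
    refine Finset.sum_le_sum fun i _ => ?_
    have h0 := hσ i
    have := mul_nonneg h0.le (sq_nonneg ((H.Aᵀ *ᵥ y) i - (σ i)⁻¹ * x i))
    have e : σ i * ((H.Aᵀ *ᵥ y) i - (σ i)⁻¹ * x i) ^ 2 =
        σ i * (H.Aᵀ *ᵥ y) i ^ 2 + (σ i)⁻¹ * x i ^ 2 - 2 * ((H.Aᵀ *ᵥ y) i * x i) := by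
      field_simp
      ring
    linarith
  have h5 : 2 * ((H.Bᵀ *ᵥ y) ⬝ᵥ u) ≤ ∑ j, (H.Bᵀ *ᵥ y) j ^ 2 + ∑ j, u j ^ 2 := by
    rw [dotProduct, Finset.mul_sum, ← Finset.sum_add_distrib]
    refine Finset.sum_le_sum fun j _ => ?_
    linarith [two_mul_le_add_sq ((H.Bᵀ *ᵥ y) j) (u j)]
  have h6 := hH.ctrl_dual y
  linarith

theorem StateSpace.IsBalanced.obs_complex {H : StateSpace n m p} {σ : Fin n → ℝ}
    (hH : H.IsBalanced σ) (x : Fin n → ℂ) :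
    ∑ i, σ i * ‖(toC H.A *ᵥ x) i‖ ^ 2 + ∑ j, ‖(toC H.C *ᵥ x) j‖ ^ 2 = ∑ i, σ i * ‖x i‖ ^ 2 := by
  have hC := sum_norm_sq_eq_re_add_im (fun _ => 1) (toC H.C *ᵥ x)
  simp only [one_mul] at hC
  rw [hC, sum_norm_sq_eq_re_add_im, sum_norm_sq_eq_re_add_im σ x]
  simp only [toC_mulVec_re, toC_mulVec_im]
  linarith [hH.obs_real fun j => (x j).re, hH.obs_real fun j => (x j).im]

theorem StateSpace.IsBalanced.ctrl_complex {H : StateSpace n m p} {σ : Fin n → ℝ}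
    (hH : H.IsBalanced σ) (hσ : ∀ i, 0 < σ i) (x : Fin n → ℂ) (u : Fin m → ℂ) :
    ∑ i, (σ i)⁻¹ * ‖(toC H.A *ᵥ x + toC H.B *ᵥ u) i‖ ^ 2 ≤
      ∑ i, (σ i)⁻¹ * ‖x i‖ ^ 2 + ∑ j, ‖u j‖ ^ 2 := by
  have hu := sum_norm_sq_eq_re_add_im (fun _ => 1) u
  simp only [one_mul] at hu
  rw [hu, sum_norm_sq_eq_re_add_im, sum_norm_sq_eq_re_add_im (fun i => (σ i)⁻¹) x]
  simp only [Pi.add_apply, Complex.add_re, Complex.add_im, toC_mulVec_re, toC_mulVec_im]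
  have h1 := hH.ctrl_real hσ (fun j => (x j).re) fun j => (u j).re
  have h2 := hH.ctrl_real hσ (fun j => (x j).im) fun j => (u j).im
  simp only [Pi.add_apply] at h1 h2
  linarith

/-! ### States of the truncated systems -/

theorem StateSpace.definedAt_of_schurStable {H : StateSpace n m p} (hH : H.SchurStable) {z : ℂ}
    (hz : 1 ≤ ‖z‖) : H.DefinedAt z := by
  unfold StateSpace.DefinedAt
  by_contra h
  refine absurd (hH z ?_) (not_lt.2 hz)
  rwa [spectrum.mem_iff, Matrix.isUnit_iff_isUnit_det, Algebra.algebraMap_eq_smul_one]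

theorem StateSpace.DefinedAt.eq_zero {H : StateSpace n m p} {z : ℂ} (h : H.DefinedAt z)
    {x : Fin n → ℂ} (hx : toC H.A *ᵥ x = z • x) : x = 0 := by
  refine Matrix.eq_zero_of_mulVec_eq_zero (M := z • (1 : Matrix (Fin n) (Fin n) ℂ) - toC H.A)
    (IsUnit.ne_zero h) ?_
  rw [sub_mulVec, smul_mulVec, one_mulVec, hx, sub_self]

/-- `x` is the state of the order-`k` truncation of `H` at the point `z` under the forcing term
`f`: the first `k` coordinates solve the truncated state equation and the others are zero. All
truncations are thus compared inside the full state space. -/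
structure StateSpace.IsTruncState (H : StateSpace n m p) (z : ℂ) (k : ℕ) (f x : Fin n → ℂ) :
    Prop where
  eq_zero : ∀ i : Fin n, k ≤ i → x i = 0
  state : ∀ i : Fin n, (i : ℕ) < k → z * x i = (toC H.A *ᵥ x) i + f i

/-- Truncations of a balanced stable system have no eigenvalue `z` with `1 ≤ ‖z‖`: the
observability identity forces the discarded coordinates of `A x` to vanish, so an eigenvector of
the truncation would be one of `A`. -/
theorem StateSpace.IsBalanced.truncState_eq_zero {H : StateSpace n m p} {σ : Fin n → ℝ}
    (hH : H.IsBalanced σ) (hσ : ∀ i, 0 < σ i) {z : ℂ} (hz : 1 ≤ ‖z‖) (hd : H.DefinedAt z) {k : ℕ}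
    {x : Fin n → ℂ} (hx : H.IsTruncState z k 0 x) : x = 0 := by
  have hle : ∀ i, σ i * ‖x i‖ ^ 2 ≤ σ i * ‖(toC H.A *ᵥ x) i‖ ^ 2 := by
    intro i
    refine mul_le_mul_of_nonneg_left ?_ (hσ i).le
    by_cases hi : (i : ℕ) < k
    · have := hx.state i hi
      rw [Pi.zero_apply, add_zero] at this
      rw [← this, norm_mul, mul_pow]
      exact le_mul_of_one_le_left (by positivity) (one_le_pow₀ hz)
    · rw [hx.eq_zero i (not_lt.1 hi)]
      simp
  have hobs := hH.obs_complex x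
  have hC : 0 ≤ ∑ j, ‖(toC H.C *ᵥ x) j‖ ^ 2 := by positivity
  have heq := (Finset.sum_eq_sum_iff_of_le fun i _ => hle i).1
    (le_antisymm (Finset.sum_le_sum fun i _ => hle i) (by linarith))
  refine hd.eq_zero (funext fun i => ?_)
  by_cases hi : (i : ℕ) < k
  · simpa using (hx.state i hi).symm
  · have := heq i (Finset.mem_univ i)
    rw [hx.eq_zero i (not_lt.1 hi)] at this
    simpa [hx.eq_zero i (not_lt.1 hi), (hσ i).ne'] using this

theorem StateSpace.IsBalanced.exists_truncState {H : StateSpace n m p} {σ : Fin n → ℝ}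
    (hH : H.IsBalanced σ) (hσ : ∀ i, 0 < σ i) {z : ℂ} (hz : 1 ≤ ‖z‖) (hd : H.DefinedAt z) (k : ℕ)
    (f : Fin n → ℂ) : ∃ x, H.IsTruncState z k f x := by
  have hz0 : z ≠ 0 := norm_pos_iff.1 (one_pos.trans_le hz)
  set π : Fin n → ℂ := fun i => if (i : ℕ) < k then 1 else 0 with hπ
  set M : Matrix (Fin n) (Fin n) ℂ := z • 1 - diagonal π * toC H.A with hM
  have hMx : ∀ x i, (M *ᵥ x) i = z * x i - π i * (toC H.A *ᵥ x) i := by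
    intro x i
    rw [hM, sub_mulVec, smul_mulVec, one_mulVec, ← mulVec_mulVec, Pi.sub_apply, mulVec_diagonal]
    rfl
  have key : ∀ x f, (M *ᵥ x = fun i => π i * f i) → H.IsTruncState z k f x := by
    intro x f h
    refine ⟨fun i hi => ?_, fun i hi => ?_⟩
    · have := congrFun h i
      rw [hMx] at this
      simpa [hπ, not_lt.2 hi, hz0] using this
    · have := congrFun h i
      rw [hMx] at this
      simp only [hπ, if_pos hi, one_mul] at this
      linear_combination this
  have hdet : IsUnit M.det := by
    rw [isUnit_iff_ne_zero]
    intro h0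
    obtain ⟨v, hv, hMv⟩ := Matrix.exists_mulVec_eq_zero_iff.2 h0
    exact hv (hH.truncState_eq_zero hσ hz hd (key v 0 (by rw [hMv]; ext; simp)))
  refine ⟨M⁻¹ *ᵥ fun i => π i * f i, key _ f ?_⟩
  rw [mulVec_mulVec, mul_nonsing_inv _ hdet, one_mulVec]

/-! ### Removing one state -/

theorem sum_add_le_sum_of_norm_le {w : Fin n → ℝ} (hw : ∀ i, 0 ≤ w i) {d e : Fin n → ℂ} (k : Fin n)
    (h : ∀ i, i ≠ k → ‖d i‖ ≤ ‖e i‖) :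
    ∑ i, w i * ‖d i‖ ^ 2 + w k * (‖e k‖ ^ 2 - ‖d k‖ ^ 2) ≤ ∑ i, w i * ‖e i‖ ^ 2 := by
  rw [← Finset.add_sum_erase _ _ (Finset.mem_univ k),
    ← Finset.add_sum_erase _ (fun i => w i * ‖e i‖ ^ 2) (Finset.mem_univ k)]
  have := Finset.sum_le_sum (s := Finset.univ.erase k) (f := fun i => w i * ‖d i‖ ^ 2)
    (g := fun i => w i * ‖e i‖ ^ 2) fun i hi =>
      mul_le_mul_of_nonneg_left (pow_le_pow_left₀ (norm_nonneg _) (h i (Finset.ne_of_mem_erase hi)) 2)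
        (hw i)
  linarith

/-- Removing the state `k` changes the output by at most `2 σ k` times the input. The difference of
the two states is put into the observability identity and their sum into the controllability
inequality. The residual `v` of the removed equation enters these with opposite signs, so its cross
terms cancel. -/
theorem StateSpace.IsBalanced.norm_output_sub_le {H : StateSpace n m p} {σ : Fin n → ℝ}
    (hH : H.IsBalanced σ) (hσ : ∀ i, 0 < σ i) {z : ℂ} (hz : 1 ≤ ‖z‖) (k : Fin n) (u : Fin m → ℂ)
    {x x' : Fin n → ℂ} (hx : H.IsTruncState z k (toC H.B *ᵥ u) x)
    (hx' : H.IsTruncState z (k + 1) (toC H.B *ᵥ u) x') :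
    ‖WithLp.toLp 2 (toC H.C *ᵥ x' - toC H.C *ᵥ x)‖ ≤ 2 * σ k * ‖WithLp.toLp 2 u‖ := by
  set f := toC H.B *ᵥ u with hf
  set v := (toC H.A *ᵥ x) k + f k with hv
  have hxk : x k = 0 := hx.eq_zero k le_rfl
  have hx'k := hx'.state k (Nat.lt_succ_self _)
  have hle : ∀ a : ℂ, ‖a‖ ≤ ‖z * a‖ := fun a => by
    rw [norm_mul]
    exact le_mul_of_one_le_left (norm_nonneg _) hz
  have hd : ∀ i, i ≠ k → ‖(x' - x) i‖ ≤ ‖(toC H.A *ᵥ (x' - x)) i‖ := by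
    intro i hik
    rcases lt_or_gt_of_ne (Fin.val_ne_of_ne hik) with hi | hi
    · have : (toC H.A *ᵥ (x' - x)) i = z * (x' - x) i := by
        rw [mulVec_sub, Pi.sub_apply, Pi.sub_apply, mul_sub, hx.state i hi, hx'.state i (by omega)]
        ring
      rw [this]
      exact hle _
    · rw [Pi.sub_apply, hx.eq_zero i hi.le, hx'.eq_zero i hi]
      simp
  have hs : ∀ i, i ≠ k →
      ‖(x' + x) i‖ ≤ ‖(toC H.A *ᵥ (x' + x) + toC H.B *ᵥ ((2 : ℂ) • u)) i‖ := by
    intro i hik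
    rcases lt_or_gt_of_ne (Fin.val_ne_of_ne hik) with hi | hi
    · have : (toC H.A *ᵥ (x' + x) + toC H.B *ᵥ ((2 : ℂ) • u)) i = z * (x' + x) i := by
        rw [mulVec_add, mulVec_smul, ← hf]
        simp only [Pi.add_apply, Pi.smul_apply, smul_eq_mul]
        rw [mul_add, hx.state i hi, hx'.state i (by omega)]
        ring
      rw [this]
      exact hle _
    · rw [Pi.add_apply, hx.eq_zero i hi.le, hx'.eq_zero i hi]
      simp
  have hdk : (toC H.A *ᵥ (x' - x)) k = z * x' k - v := by
    rw [mulVec_sub, Pi.sub_apply, hx'k, hv]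
    ring
  have hsk : (toC H.A *ᵥ (x' + x) + toC H.B *ᵥ ((2 : ℂ) • u)) k = z * x' k + v := by
    rw [mulVec_add, mulVec_smul, ← hf, hx'k, hv]
    simp only [Pi.add_apply, Pi.smul_apply, smul_eq_mul]
    ring
  have h1 := sum_add_le_sum_of_norm_le (fun i => (hσ i).le) k hd
  have h2 := sum_add_le_sum_of_norm_le (fun i => (inv_pos.2 (hσ i)).le) k hs
  rw [hdk, Pi.sub_apply, hxk, sub_zero] at h1
  rw [hsk, Pi.add_apply, hxk, add_zero] at h2
  have h3 := hH.obs_complex (x' - x)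
  have h4 := hH.ctrl_complex hσ (x' + x) ((2 : ℂ) • u)
  have h5 : ∑ j, ‖((2 : ℂ) • u) j‖ ^ 2 = 4 * ∑ j, ‖u j‖ ^ 2 := by
    rw [Finset.mul_sum]
    refine Finset.sum_congr rfl fun j _ => ?_
    rw [Pi.smul_apply, norm_smul, mul_pow]
    norm_num
  -- The parallelogram law compares the defect of the observability identity with that of the
  -- controllability inequality.
  have h6 := parallelogram_law_with_norm ℝ (z * x' k) v
  have h7 : ‖x' k‖ ^ 2 ≤ ‖z * x' k‖ ^ 2 := pow_le_pow_left₀ (norm_nonneg _) (hle _) 2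
  have h8 : σ k * (‖x' k‖ ^ 2 - ‖z * x' k - v‖ ^ 2) ≤
      σ k * (‖z * x' k + v‖ ^ 2 - ‖x' k‖ ^ 2) :=
    mul_le_mul_of_nonneg_left (by nlinarith [sq_nonneg ‖v‖]) (hσ k).le
  have h9 : (σ k)⁻¹ * (‖z * x' k + v‖ ^ 2 - ‖x' k‖ ^ 2) ≤ 4 * ∑ j, ‖u j‖ ^ 2 := by linarith
  have h10 : ‖z * x' k + v‖ ^ 2 - ‖x' k‖ ^ 2 ≤ σ k * (4 * ∑ j, ‖u j‖ ^ 2) := by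
    rwa [inv_mul_le_iff₀ (hσ k)] at h9
  have h11 := mul_le_mul_of_nonneg_left h10 (hσ k).le
  refine le_of_sq_le_sq ?_ (mul_nonneg (mul_nonneg two_pos.le (hσ k).le) (norm_nonneg _))
  rw [← mulVec_sub, mul_pow, EuclideanSpace.norm_sq_eq, EuclideanSpace.norm_sq_eq]
  simp only
  nlinarith

/-! ### The error bound for balanced truncation -/

theorem StateSpace.IsBalanced.norm_output_sub_le_sum {H : StateSpace n m p} {σ : Fin n → ℝ}
    (hH : H.IsBalanced σ) (hσ : ∀ i, 0 < σ i) {z : ℂ} (hz : 1 ≤ ‖z‖) (hd : H.DefinedAt z)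
    {r k : ℕ} (hrk : r ≤ k) (hk : k ≤ n) (u : Fin m → ℂ) {x x' : Fin n → ℂ}
    (hx : H.IsTruncState z r (toC H.B *ᵥ u) x) (hx' : H.IsTruncState z k (toC H.B *ᵥ u) x') :
    ‖WithLp.toLp 2 (toC H.C *ᵥ x' - toC H.C *ᵥ x)‖ ≤
      2 * (∑ i ∈ Finset.univ.filter (fun i : Fin n => r ≤ (i : ℕ) ∧ (i : ℕ) < k), σ i) *
        ‖WithLp.toLp 2 u‖ := by
  induction k, hrk using Nat.le_induction generalizing x' with
  | base =>
    have : x' = x := by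
      refine sub_eq_zero.1 (hH.truncState_eq_zero hσ hz hd (k := r) ⟨fun i hi => ?_, fun i hi => ?_⟩)
      · rw [Pi.sub_apply, hx.eq_zero i hi, hx'.eq_zero i hi, sub_zero]
      · rw [Pi.sub_apply, mul_sub, hx.state i hi, hx'.state i hi, mulVec_sub, Pi.sub_apply,
          Pi.zero_apply]
        ring
    rw [this, sub_self, WithLp.toLp_zero, norm_zero]
    exact mul_nonneg (mul_nonneg two_pos.le (Finset.sum_nonneg fun i _ => (hσ i).le))
      (norm_nonneg _)
  | succ k hrk ih =>
    obtain ⟨y, hy⟩ := hH.exists_truncState hσ hz hd k (toC H.B *ᵥ u)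
    have h1 := ih (by omega) hy
    have h2 := hH.norm_output_sub_le hσ hz ⟨k, hk⟩ u hy hx'
    have h3 : Finset.univ.filter (fun i : Fin n => r ≤ (i : ℕ) ∧ (i : ℕ) < k + 1) =
        insert ⟨k, hk⟩ (Finset.univ.filter fun i : Fin n => r ≤ (i : ℕ) ∧ (i : ℕ) < k) := by
      ext i
      simp only [Finset.mem_filter, Finset.mem_univ, true_and, Finset.mem_insert, Fin.ext_iff]
      omega
    rw [h3, Finset.sum_insert (by simp)]
    have h4 : WithLp.toLp 2 (toC H.C *ᵥ x' - toC H.C *ᵥ x) =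
        WithLp.toLp 2 (toC H.C *ᵥ x' - toC H.C *ᵥ y) +
          WithLp.toLp 2 (toC H.C *ᵥ y - toC H.C *ᵥ x) := by
      rw [← WithLp.toLp_add, sub_add_sub_cancel]
    rw [h4]
    refine (norm_add_le _ _).trans ?_
    linarith

/-- Extension of a vector of the first `r` coordinates by zero. -/
def extendZero {r : ℕ} (x : Fin r → ℂ) (i : Fin n) : ℂ :=
  if h : (i : ℕ) < r then x ⟨i, h⟩ else 0

theorem mulVec_extendZero {r l : ℕ} (hr : r ≤ n) (M : Matrix (Fin l) (Fin n) ℂ) (x : Fin r → ℂ) :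
    M *ᵥ (extendZero x : Fin n → ℂ) = M.submatrix id (Fin.castLE hr) *ᵥ x := by
  ext i
  simp only [mulVec, dotProduct, submatrix_apply, id]
  symm
  refine Finset.sum_of_injOn (Fin.castLE hr) (Fin.castLE_injective hr).injOn (by simp) ?_ ?_
  · intro j _ hj
    have : ¬ (j : ℕ) < r := fun h => hj ⟨⟨j, h⟩, by simp, rfl⟩
    simp [extendZero, this]
  · intro j _
    simp [extendZero]

theorem StateSpace.DefinedAt.resolvent_state {H : StateSpace n m p} {z : ℂ} (h : H.DefinedAt z)
    (f : Fin n → ℂ) {x : Fin n → ℂ}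
    (hx : x = (z • (1 : Matrix (Fin n) (Fin n) ℂ) - toC H.A)⁻¹ *ᵥ f) :
    z • x = toC H.A *ᵥ x + f := by
  have h1 : (z • (1 : Matrix (Fin n) (Fin n) ℂ) - toC H.A) *ᵥ x = f := by
    rw [hx, mulVec_mulVec, mul_nonsing_inv _ h, one_mulVec]
  rw [sub_mulVec, smul_mulVec, one_mulVec] at h1
  rw [← h1]
  abel

theorem StateSpace.isTruncState_extendZero {r : ℕ} (hr : r ≤ n) {H : StateSpace n m p} {z : ℂ}
    {f : Fin n → ℂ} {x : Fin r → ℂ}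
    (hx : z • x = toC (H.truncate hr).A *ᵥ x + fun i => f (Fin.castLE hr i)) :
    H.IsTruncState z r f (extendZero x) := by
  refine ⟨fun i hi => by simp [extendZero, not_lt.2 hi], fun i hi => ?_⟩
  have := congrFun hx ⟨i, hi⟩
  rw [mulVec_extendZero hr]
  simp only [extendZero, hi, dif_pos]
  exact this

theorem StateSpace.IsBalanced.definedAt_truncate {r : ℕ} (hr : r ≤ n) {H : StateSpace n m p}
    {σ : Fin n → ℝ} (hH : H.IsBalanced σ) (hσ : ∀ i, 0 < σ i) {z : ℂ} (hz : 1 ≤ ‖z‖)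
    (hd : H.DefinedAt z) : (H.truncate hr).DefinedAt z := by
  unfold StateSpace.DefinedAt
  rw [isUnit_iff_ne_zero]
  intro h0
  obtain ⟨v, hv, hMv⟩ := Matrix.exists_mulVec_eq_zero_iff.2 h0
  rw [sub_mulVec, smul_mulVec, one_mulVec, sub_eq_zero] at hMv
  have h1 := hH.truncState_eq_zero hσ hz hd
    (StateSpace.isTruncState_extendZero hr (f := 0) (x := v) (by rw [hMv]; ext; simp))
  refine hv (funext fun i => ?_)
  simpa [extendZero] using congrFun h1 (Fin.castLE hr i)

theorem StateSpace.transfer_mulVec (H : StateSpace n m p) (z : ℂ) (u : Fin m → ℂ) :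
    H.transfer z *ᵥ u = toC H.C *ᵥ ((z • (1 : Matrix (Fin n) (Fin n) ℂ) - toC H.A)⁻¹ *ᵥ
      (toC H.B *ᵥ u)) + toC H.D *ᵥ u := by
  rw [StateSpace.transfer, add_mulVec, mulVec_mulVec, mulVec_mulVec]

theorem StateSpace.IsBalanced.norm_transfer_sub_truncate_le {r : ℕ} (hr : r ≤ n)
    {H : StateSpace n m p} {σ : Fin n → ℝ} (hH : H.IsBalanced σ) (hσ : ∀ i, 0 < σ i) {z : ℂ}
    (hz : 1 ≤ ‖z‖) (hd : H.DefinedAt z) (u : Fin m → ℂ) :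
    ‖WithLp.toLp 2 ((H.transfer z - (H.truncate hr).transfer z) *ᵥ u)‖ ≤
      2 * (∑ i ∈ Finset.univ.filter (fun i : Fin n => r ≤ (i : ℕ)), σ i) *
        ‖WithLp.toLp 2 u‖ := by
  set x := (z • (1 : Matrix (Fin n) (Fin n) ℂ) - toC H.A)⁻¹ *ᵥ (toC H.B *ᵥ u) with hx
  set y := (z • (1 : Matrix (Fin r) (Fin r) ℂ) - toC (H.truncate hr).A)⁻¹ *ᵥ
    (toC (H.truncate hr).B *ᵥ u) with hy
  have hxs : H.IsTruncState z n (toC H.B *ᵥ u) x :=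
    ⟨fun i hi => absurd i.2 (not_lt.2 hi), fun i _ => congrFun (hd.resolvent_state _ hx) i⟩
  have hys : H.IsTruncState z r (toC H.B *ᵥ u) (extendZero y) :=
    StateSpace.isTruncState_extendZero hr
      ((hH.definedAt_truncate hr hσ hz hd).resolvent_state _ hy)
  have h := hH.norm_output_sub_le_sum hσ hz hd hr le_rfl u hys hxs
  have e : (H.transfer z - (H.truncate hr).transfer z) *ᵥ u =
      toC H.C *ᵥ x - toC H.C *ᵥ (extendZero y : Fin n → ℂ) := by
    rw [sub_mulVec, StateSpace.transfer_mulVec, StateSpace.transfer_mulVec, ← hx, ← hy,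
      mulVec_extendZero hr]
    exact add_sub_add_right_eq_sub _ _ _
  rw [e]
  simpa using h

/-! ### Balancing by a change of coordinates -/

theorem toC_mul {j k l : ℕ} (M : Matrix (Fin j) (Fin k) ℝ) (N : Matrix (Fin k) (Fin l) ℝ) :
    toC (M * N) = toC M * toC N :=
  Matrix.map_mul (f := Complex.ofRealHom)

theorem toC_add {k l : ℕ} (M N : Matrix (Fin k) (Fin l) ℝ) : toC (M + N) = toC M + toC N := by
  ext i j
  simp [toC]

theorem toC_sub {k l : ℕ} (M N : Matrix (Fin k) (Fin l) ℝ) : toC (M - N) = toC M - toC N := by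
  ext i j
  simp [toC]

theorem toC_smul {k l : ℕ} (c : ℝ) (M : Matrix (Fin k) (Fin l) ℝ) :
    toC (c • M) = (c : ℂ) • toC M := by
  ext i j
  simp [toC]

theorem toC_one {k : ℕ} : toC (1 : Matrix (Fin k) (Fin k) ℝ) = 1 :=
  Matrix.map_one _ Complex.ofReal_zero Complex.ofReal_one

theorem isUnit_det_toC {k : ℕ} (M : Matrix (Fin k) (Fin k) ℝ) :
    IsUnit (toC M).det ↔ IsUnit M.det := by
  have : (toC M).det = (M.det : ℂ) := (Complex.ofRealHom.map_det M).symm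
  rw [this, isUnit_iff_ne_zero, isUnit_iff_ne_zero, Complex.ofReal_ne_zero]

/-- Conjugation of the pencil `z I - A` by the change of coordinates. -/
theorem smul_one_sub_toC_changeCoord (G : StateSpace n m p) {T : Matrix (Fin n) (Fin n) ℝ}
    (hT : IsUnit T.det) (z : ℂ) :
    z • (1 : Matrix (Fin n) (Fin n) ℂ) - toC (G.changeCoord T).A =
      toC T * (z • (1 : Matrix (Fin n) (Fin n) ℂ) - toC G.A) * toC T⁻¹ := by
  have h : toC T * toC T⁻¹ = 1 := by rw [← toC_mul, mul_nonsing_inv _ hT, toC_one]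
  rw [mul_sub, sub_mul, mul_smul_comm, mul_one, smul_mul_assoc, h]
  simp only [StateSpace.changeCoord, toC_mul]

theorem StateSpace.DefinedAt.changeCoord {G : StateSpace n m p} {z : ℂ} (h : G.DefinedAt z)
    {T : Matrix (Fin n) (Fin n) ℝ} (hT : IsUnit T.det) : (G.changeCoord T).DefinedAt z := by
  unfold StateSpace.DefinedAt
  rw [smul_one_sub_toC_changeCoord G hT, det_mul, det_mul]
  exact (((isUnit_det_toC T).2 hT).mul h).mul
    ((isUnit_det_toC _).2 (isUnit_nonsing_inv_det _ hT))

theorem StateSpace.DefinedAt.transfer_changeCoord {G : StateSpace n m p} {z : ℂ}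
    (h : G.DefinedAt z) {T : Matrix (Fin n) (Fin n) ℝ} (hT : IsUnit T.det) :
    (G.changeCoord T).transfer z = G.transfer z := by
  set R := (z • (1 : Matrix (Fin n) (Fin n) ℂ) - toC G.A)⁻¹ with hR
  have h1 : toC T * toC T⁻¹ = 1 := by rw [← toC_mul, mul_nonsing_inv _ hT, toC_one]
  have h2 : toC T⁻¹ * toC T = 1 := by rw [← toC_mul, nonsing_inv_mul _ hT, toC_one]
  have h3 : (z • (1 : Matrix (Fin n) (Fin n) ℂ) - toC (G.changeCoord T).A)⁻¹ =
      toC T * R * toC T⁻¹ := by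
    refine inv_eq_right_inv ?_
    rw [smul_one_sub_toC_changeCoord G hT]
    calc _ = toC T * (z • (1 : Matrix (Fin n) (Fin n) ℂ) - toC G.A) * (toC T⁻¹ * toC T) * R *
          toC T⁻¹ := by simp only [Matrix.mul_assoc]
      _ = 1 := by rw [h2, Matrix.mul_one, Matrix.mul_assoc (toC T), hR, mul_nonsing_inv _ h,
          Matrix.mul_one, h1]
  rw [StateSpace.transfer, h3]
  simp only [StateSpace.changeCoord, toC_mul, StateSpace.transfer, ← hR]
  congr 1
  calc _ = toC G.C * (toC T⁻¹ * toC T) * R * (toC T⁻¹ * toC T) * toC G.B := by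
        simp only [Matrix.mul_assoc]
    _ = _ := by rw [h2, Matrix.mul_one, Matrix.mul_one]

/-- If `T` carries both Gramians to `diag σ`, then it balances the realization. -/
theorem isBalanced_changeCoord {G : StateSpace n m p} {P Q T : Matrix (Fin n) (Fin n) ℝ}
    {σ : Fin n → ℝ} (hT : IsUnit T.det) (hc : G.A * P * G.Aᵀ - P + G.B * G.Bᵀ = 0)
    (ho : G.Aᵀ * Q * G.A - Q + G.Cᵀ * G.C = 0) (hP : P = T⁻¹ * diagonal σ * T⁻¹ᵀ)
    (hQ : Q = Tᵀ * diagonal σ * T) : (G.changeCoord T).IsBalanced σ := by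
  have h1 : T * T⁻¹ = 1 := mul_nonsing_inv _ hT
  have h2 : T⁻¹ᵀ * Tᵀ = 1 := by rw [← transpose_mul, h1, transpose_one]
  have hc' : G.A * P * G.Aᵀ + G.B * G.Bᵀ = P := by
    rw [← sub_eq_zero, ← hc]
    abel
  have ho' : G.Aᵀ * Q * G.A + G.Cᵀ * G.C = Q := by
    rw [← sub_eq_zero, ← ho]
    abel
  refine ⟨?_, ?_⟩
  · calc _ = T * (G.A * (T⁻¹ * diagonal σ * T⁻¹ᵀ) * G.Aᵀ + G.B * G.Bᵀ) * Tᵀ := by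
          simp only [StateSpace.changeCoord, transpose_mul, mul_add, add_mul, Matrix.mul_assoc]
      _ = (T * T⁻¹) * diagonal σ * (T⁻¹ᵀ * Tᵀ) := by
          rw [← hP, hc', hP]
          simp only [Matrix.mul_assoc]
      _ = _ := by rw [h1, h2, Matrix.one_mul, Matrix.mul_one]
  · calc _ = T⁻¹ᵀ * (G.Aᵀ * (Tᵀ * diagonal σ * T) * G.A + G.Cᵀ * G.C) * T⁻¹ := by
          simp only [StateSpace.changeCoord, transpose_mul, mul_add, add_mul, Matrix.mul_assoc]
      _ = (T⁻¹ᵀ * Tᵀ) * diagonal σ * (T * T⁻¹) := by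
          rw [← hQ, ho', hQ]
          simp only [Matrix.mul_assoc]
      _ = _ := by rw [h1, h2, Matrix.one_mul, Matrix.mul_one]

theorem IsBalancingData.isBalanced {G : StateSpace n m p} {P Q U V : Matrix (Fin n) (Fin n) ℝ}
    {σ : Fin n → ℝ} (h : IsBalancingData G P Q U V σ) :
    IsUnit (balancingT U V σ).det ∧ (G.changeCoord (balancingT U V σ)).IsBalanced σ := by
  set S : Matrix (Fin n) (Fin n) ℝ := diagonal fun i => √(σ i) with hS
  set S' : Matrix (Fin n) (Fin n) ℝ := diagonal fun i => (√(σ i))⁻¹ with hS'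
  have hsq : ∀ i, √(σ i) ≠ 0 := fun i => (Real.sqrt_pos.2 (h.sigma_pos i)).ne'
  have hmul : ∀ i, √(σ i) * √(σ i) = σ i := fun i => Real.mul_self_sqrt (h.sigma_pos i).le
  have hSS' : S * S' = 1 := by
    rw [hS, hS', diagonal_mul_diagonal, ← diagonal_one]
    exact congrArg _ (funext fun i => mul_inv_cancel₀ (hsq i))
  have hVV : Vᵀ * V = 1 := (mem_orthogonalGroup_iff' (Fin n) ℝ).1 h.orthogonal
  have hVV' : V * Vᵀ = 1 := (mem_orthogonalGroup_iff (Fin n) ℝ).1 h.orthogonal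
  have hU : U⁻¹ * U = 1 := nonsing_inv_mul _ h.isUnit_U
  have hU' : U * U⁻¹ = 1 := mul_nonsing_inv _ h.isUnit_U
  have hTW : balancingT U V σ * (U * V * S') = 1 := by
    calc _ = S * (Vᵀ * ((U⁻¹ * U) * V)) * S' := by
          simp only [balancingT, ← hS, Matrix.mul_assoc]
      _ = 1 := by rw [hU, Matrix.one_mul, hVV, Matrix.mul_one, hSS']
  have hinv : (balancingT U V σ)⁻¹ = U * V * S' := inv_eq_right_inv hTW
  have hdet : IsUnit (balancingT U V σ).det := isUnit_det_of_right_inverse hTW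
  refine ⟨hdet, isBalanced_changeCoord hdet h.lyap_ctrl h.lyap_obs ?_ ?_⟩
  · have h1 : S' * diagonal σ * S' = 1 := by
      rw [hS', diagonal_mul_diagonal, diagonal_mul_diagonal, ← diagonal_one]
      refine congrArg _ (funext fun i => ?_)
      have := hsq i
      nth_rewrite 2 [← hmul i]
      field_simp
    calc P = U * (V * 1 * Vᵀ) * Uᵀ := by rw [Matrix.mul_one, hVV', Matrix.mul_one, h.factor]
      _ = _ := by
        rw [hinv, ← h1]
        simp only [transpose_mul, hS', diagonal_transpose, Matrix.mul_assoc]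
  · have h1 : S * diagonal σ * S = diagonal fun i => σ i ^ 2 := by
      rw [hS, diagonal_mul_diagonal, diagonal_mul_diagonal]
      refine congrArg _ (funext fun i => ?_)
      linear_combination σ i * hmul i
    have h2 : U⁻¹ᵀ * Uᵀ = 1 := by rw [← transpose_mul, hU', transpose_one]
    calc Q = (U⁻¹ᵀ * Uᵀ) * Q * (U * U⁻¹) := by rw [h2, hU', Matrix.one_mul, Matrix.mul_one]
      _ = U⁻¹ᵀ * (Uᵀ * Q * U) * U⁻¹ := by simp only [Matrix.mul_assoc]
      _ = _ := by
        rw [h.eigen, ← h1]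
        simp only [balancingT, ← hS, transpose_mul, transpose_transpose, Matrix.mul_assoc]
        rw [hS, diagonal_transpose]

theorem IsLyaBT.definedAt {r : ℕ} {hr : r ≤ n} {H : StateSpace n m p} {σ : Fin n → ℝ}
    {S : StateSpace r m p} (h : IsLyaBT hr H σ S) (hH : H.SchurStable) {z : ℂ} (hz : 1 ≤ ‖z‖) :
    S.DefinedAt z := by
  obtain ⟨P, Q, U, V, hb, rfl⟩ := h
  obtain ⟨hT, hbal⟩ := hb.isBalanced
  exact hbal.definedAt_truncate hr hb.sigma_pos hz
    ((StateSpace.definedAt_of_schurStable hH hz).changeCoord hT)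

/-- The error bound of discrete-time balanced truncation, on and outside the unit circle and up to
a scaling factor. -/
theorem IsLyaBT.sigmaMax_smul_sub_le {r : ℕ} {hr : r ≤ n} {H : StateSpace n m p} {σ : Fin n → ℝ}
    {S : StateSpace r m p} (h : IsLyaBT hr H σ S) (hH : H.SchurStable) {z : ℂ} (hz : 1 ≤ ‖z‖)
    {c : ℝ} (hc : 0 ≤ c) :
    sigmaMax ((c : ℂ) • H.transfer z - (c : ℂ) • S.transfer z) ≤
      2 * c * ∑ i ∈ Finset.univ.filter (fun i : Fin n => r ≤ (i : ℕ)), σ i := by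
  obtain ⟨P, Q, U, V, hb, rfl⟩ := h
  obtain ⟨hT, hbal⟩ := hb.isBalanced
  have hd := StateSpace.definedAt_of_schurStable hH hz
  refine sigmaMax_le _ (mul_nonneg (mul_nonneg two_pos.le hc)
    (Finset.sum_nonneg fun i _ => (hb.sigma_pos i).le)) fun u => ?_
  have hb := hbal.norm_transfer_sub_truncate_le hr hb.sigma_pos hz (hd.changeCoord hT) u
  rw [hd.transfer_changeCoord hT] at hb
  rw [← smul_sub, smul_mulVec, WithLp.toLp_smul, norm_smul, Complex.norm_of_nonneg hc]
  linarith [mul_le_mul_of_nonneg_left hb hc]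

/-! ### The upper type mapping -/

theorem upperMap_upperInv {w : ℝ} (hw : 0 < w) (ρ : ℝ) (S : StateSpace n m p) :
    upperMap w ρ (upperInv w ρ S) = S := by
  have hc : √(ρ ^ 2 + w ^ 2) ≠ 0 := (Real.sqrt_pos.2 (by positivity)).ne'
  simp [upperMap, upperInv, smul_smul, inv_mul_cancel₀ hc]

theorem transfer_eq_upperMap {w : ℝ} (hw : 0 < w) (ρ : ℝ) (G : StateSpace n m p) {s z : ℂ}
    (hz : (√(ρ ^ 2 + w ^ 2) : ℝ) * z = s + ρ) (hd : (upperMap w ρ G).DefinedAt z) :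
    G.DefinedAt s ∧
      G.transfer s = ((√(ρ ^ 2 + w ^ 2) : ℝ) : ℂ) • (upperMap w ρ G).transfer z := by
  set c := √(ρ ^ 2 + w ^ 2) with hcdef
  have hc : (c : ℂ) ≠ 0 := Complex.ofReal_ne_zero.2 (Real.sqrt_pos.2 (by positivity)).ne'
  set K := z • (1 : Matrix (Fin n) (Fin n) ℂ) - toC (upperMap w ρ G).A with hK
  have hs : s • (1 : Matrix (Fin n) (Fin n) ℂ) - toC G.A = (c : ℂ) • K := by
    rw [hK, upperMap, ← hcdef, toC_smul, toC_add, toC_smul, toC_one, smul_sub, smul_smul, smul_smul,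
      hz, Complex.ofReal_inv, mul_inv_cancel₀ hc, one_smul, add_smul]
    abel
  refine ⟨?_, ?_⟩
  · unfold StateSpace.DefinedAt
    rw [hs, det_smul]
    exact ((isUnit_iff_ne_zero.2 hc).pow _).mul hd
  · have hinv : ((c : ℂ) • K)⁻¹ = (c : ℂ)⁻¹ • K⁻¹ := by
      refine inv_eq_right_inv ?_
      rw [smul_mul_smul_comm, mul_inv_cancel₀ hc, one_smul, mul_nonsing_inv _ hd]
    rw [StateSpace.transfer, hs, hinv, StateSpace.transfer, ← hK]
    simp only [upperMap, ← hcdef, toC_smul, Matrix.smul_mul, Matrix.mul_smul, smul_add, smul_smul,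
      Complex.ofReal_inv, mul_inv_cancel₀ hc, one_smul, mul_inv_cancel_left₀ hc]

/-! ### The lower type mapping -/

theorem lowerMap_lowerInv {w : ℝ} (hw : 0 < w) (ρ : ℝ) (S : StateSpace n m p)
    (hS : IsUnit ((1 : Matrix (Fin n) (Fin n) ℝ) + (ρ * (√(ρ ^ 2 + 1))⁻¹) • S.A).det) :
    IsUnit (w • (1 : Matrix (Fin n) (Fin n) ℝ) - ρ • (lowerInv w ρ S).A).det ∧
      lowerMap w ρ (lowerInv w ρ S) = S := by
  have hk : √(ρ ^ 2 + 1) ≠ 0 := (Real.sqrt_pos.2 (by positivity)).ne'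
  set k := √(ρ ^ 2 + 1) with hkdef
  set X := (1 : Matrix (Fin n) (Fin n) ℝ) + (ρ * k⁻¹) • S.A with hX
  have hXX : X * X⁻¹ = 1 := mul_nonsing_inv _ hS
  have hXX' : X⁻¹ * X = 1 := nonsing_inv_mul _ hS
  have hN : w • (1 : Matrix (Fin n) (Fin n) ℝ) - ρ • lowerInvA w ρ S = w • X⁻¹ := by
    have : w • X⁻¹ + ρ • lowerInvA w ρ S = w • (X * X⁻¹) := by
      simp only [lowerInvA, ← hkdef, ← hX]
      nth_rewrite 3 [hX]
      rw [add_mul, one_mul, smul_mul_assoc, smul_add, smul_smul, smul_smul]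
      ring_nf
    rw [← hXX, ← this, add_sub_cancel_right]
  have hmul : (w • X⁻¹) * (w⁻¹ • X) = 1 := by
    rw [smul_mul_smul_comm, mul_inv_cancel₀ hw.ne', one_smul, hXX']
  have hmul' : (w⁻¹ • X) * (w • X⁻¹) = 1 := by
    rw [smul_mul_smul_comm, inv_mul_cancel₀ hw.ne', one_smul, hXX]
  have hNinv : (w • X⁻¹)⁻¹ = w⁻¹ • X := inv_eq_right_inv hmul
  refine ⟨?_, ?_⟩
  · change IsUnit (w • (1 : Matrix (Fin n) (Fin n) ℝ) - ρ • lowerInvA w ρ S).det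
    rw [hN]
    exact isUnit_det_of_right_inverse hmul
  · obtain ⟨A, B, C, D⟩ := S
    simp only [lowerMap, lowerInv, ← hkdef]
    rw [hN, hNinv]
    congr 1
    · simp only [lowerInvA, ← hkdef]
      rw [← hX, smul_mul_smul_comm, smul_smul, Matrix.mul_assoc, hXX', Matrix.mul_one]
      rw [show k * (w * k⁻¹ * w⁻¹) = 1 by have := hw.ne'; field_simp, one_smul]
    · rw [lowerInvB, hN, ← Matrix.mul_assoc, hmul', Matrix.one_mul]
    · rw [lowerInvC, hN, Matrix.mul_assoc, hmul, Matrix.mul_one]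
    · rw [smul_smul, smul_sub, smul_smul,
        show k⁻¹ * w⁻¹ * (w * k) = 1 by have := hw.ne'; field_simp, one_smul,
        show 1 * (ρ * k⁻¹ * w⁻¹) = k⁻¹ * w⁻¹ * ρ by ring]
      abel

theorem transfer_eq_lowerMap {w : ℝ} (hw : 0 < w) (ρ : ℝ) (G : StateSpace n m p) {s z : ℂ}
    (hN : IsUnit (w • (1 : Matrix (Fin n) (Fin n) ℝ) - ρ • G.A).det) (hα : (w : ℂ) - ρ * s ≠ 0)
    (hz : z * (w - ρ * s) = (√(ρ ^ 2 + 1) : ℝ) * s) (hd : (lowerMap w ρ G).DefinedAt z) :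
    G.DefinedAt s ∧
      G.transfer s = ((w * √(ρ ^ 2 + 1) : ℝ) : ℂ) • (lowerMap w ρ G).transfer z := by
  set k := √(ρ ^ 2 + 1) with hkdef
  have hk : (k : ℂ) ≠ 0 := Complex.ofReal_ne_zero.2 (Real.sqrt_pos.2 (by positivity)).ne'
  have hw' : (w : ℂ) ≠ 0 := Complex.ofReal_ne_zero.2 hw.ne'
  set N := w • (1 : Matrix (Fin n) (Fin n) ℝ) - ρ • G.A with hNdef
  have hNC : toC N = (w : ℂ) • 1 - (ρ : ℂ) • toC G.A := by
    rw [hNdef, toC_sub, toC_smul, toC_smul, toC_one]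
  have hNM : toC N * toC N⁻¹ = 1 := by rw [← toC_mul, mul_nonsing_inv _ hN, toC_one]
  have hMN : toC N⁻¹ * toC N = 1 := by rw [← toC_mul, nonsing_inv_mul _ hN, toC_one]
  set α : ℂ := w - ρ * s with hαdef
  set K := z • (1 : Matrix (Fin n) (Fin n) ℂ) - toC (lowerMap w ρ G).A with hK
  have hKK : K * K⁻¹ = 1 := mul_nonsing_inv _ hd
  have hKN : α • (K * toC N) = (k * w : ℂ) • (s • 1 - toC G.A) := by
    have h1 : K * toC N = z • toC N - (k : ℂ) • toC G.A := by
      rw [hK, lowerMap, ← hkdef, ← hNdef, toC_smul, toC_mul, sub_mul, smul_mul_assoc, one_mul,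
        smul_mul_assoc, Matrix.mul_assoc, hMN, Matrix.mul_one]
    rw [h1, hNC]
    ext i j
    simp only [Matrix.smul_apply, Matrix.sub_apply, smul_eq_mul]
    rw [hαdef] at *
    linear_combination ((w : ℂ) * (1 : Matrix (Fin n) (Fin n) ℂ) i j - ρ * toC G.A i j) * hz
  have hs : s • (1 : Matrix (Fin n) (Fin n) ℂ) - toC G.A = (α / (k * w)) • (K * toC N) := by
    rw [div_eq_inv_mul, ← smul_smul, hKN, smul_smul, inv_mul_cancel₀ (mul_ne_zero hk hw'), one_smul]
  set R := (k * w / α) • (toC N⁻¹ * K⁻¹) with hR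
  have hsR : (s • (1 : Matrix (Fin n) (Fin n) ℂ) - toC G.A) * R = 1 := by
    rw [hs, hR, smul_mul_smul_comm, Matrix.mul_assoc, ← Matrix.mul_assoc (toC N), hNM,
      Matrix.one_mul, hKK, show α / (k * w) * (k * w / α) = 1 by field_simp, one_smul]
  have hRs : R * (s • (1 : Matrix (Fin n) (Fin n) ℂ) - toC G.A) = 1 :=
    mul_eq_one_comm.1 hsR
  refine ⟨isUnit_det_of_right_inverse hsR, ?_⟩
  -- The identity `w I - ρ A = (w - ρ s) I + ρ (s I - A)`, multiplied by both resolvents.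
  have hres : R = ((w * k : ℝ) : ℂ) • (toC N⁻¹ * K⁻¹ * toC N⁻¹) + (ρ : ℂ) • toC N⁻¹ := by
    have h1 : toC N = α • 1 + (ρ : ℂ) • (s • (1 : Matrix (Fin n) (Fin n) ℂ) - toC G.A) := by
      rw [hNC, hαdef, sub_smul, smul_sub, smul_smul]
      abel
    calc R = R * (toC N * toC N⁻¹) := by rw [hNM, Matrix.mul_one]
      _ = α • (R * toC N⁻¹) + (ρ : ℂ) • toC N⁻¹ := by
        nth_rewrite 1 [h1]
        rw [add_mul, mul_add, smul_mul_assoc α, Matrix.one_mul, smul_mul_assoc (ρ : ℂ), mul_smul_comm,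
          mul_smul_comm, ← Matrix.mul_assoc, hRs, Matrix.one_mul]
      _ = _ := by
        rw [hR, smul_mul_assoc, smul_smul, show α * (k * w / α) = ((w * k : ℝ) : ℂ) by
          push_cast; field_simp]
  rw [StateSpace.transfer, inv_eq_right_inv hsR, hres, StateSpace.transfer, ← hK]
  simp only [lowerMap, ← hkdef, ← hNdef, toC_mul, toC_add, toC_smul, Matrix.mul_add, Matrix.add_mul,
    Matrix.smul_mul, Matrix.mul_smul, smul_add, smul_smul, Matrix.mul_assoc]
  rw [show ((w * k : ℝ) : ℂ) * ((k⁻¹ * w⁻¹ * ρ : ℝ) : ℂ) = ρ by push_cast; field_simp,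
    show ((w * k : ℝ) : ℂ) * ((k⁻¹ * w⁻¹ : ℝ) : ℂ) = 1 by push_cast; field_simp, one_smul, add_assoc]

theorem isUnit_det_one_add_smul {S : StateSpace n m p} (hS : ∀ z : ℂ, 1 ≤ ‖z‖ → S.DefinedAt z)
    {κ : ℝ} (hκ : |κ| ≤ 1) : IsUnit ((1 : Matrix (Fin n) (Fin n) ℝ) + κ • S.A).det := by
  rcases eq_or_ne κ 0 with rfl | h0
  · simp
  have h0' : (κ : ℂ) ≠ 0 := Complex.ofReal_ne_zero.2 h0
  have hd := hS (-(κ : ℂ)⁻¹) (by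
    rw [norm_neg, norm_inv, Complex.norm_real, Real.norm_eq_abs]
    exact one_le_inv₀ (abs_pos.2 h0) |>.2 hκ)
  rw [← isUnit_det_toC, toC_add, toC_one, toC_smul,
    show 1 + (κ : ℂ) • toC S.A =
      (-κ : ℂ) • ((-(κ : ℂ)⁻¹) • (1 : Matrix (Fin n) (Fin n) ℂ) - toC S.A) by
      rw [smul_sub, smul_smul, neg_mul_neg, mul_inv_cancel₀ h0', one_smul, neg_smul, sub_neg_eq_add],
    det_smul]
  exact ((isUnit_iff_ne_zero.2 (neg_ne_zero.2 h0')).pow _).mul hd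

/-! ### Frequency-dependent error bounds -/

theorem one_le_norm_upper {w ρ ω : ℝ} (hw : 0 < w) (hω : w ≤ |ω|) :
    1 ≤ ‖(Complex.I * ω + ρ) / (√(ρ ^ 2 + w ^ 2) : ℝ)‖ := by
  have hc : 0 < √(ρ ^ 2 + w ^ 2) := Real.sqrt_pos.2 (by positivity)
  rw [norm_div, Complex.norm_of_nonneg hc.le, one_le_div hc]
  refine Real.sqrt_le_iff.2 ⟨norm_nonneg _, ?_⟩
  rw [Complex.sq_norm, Complex.normSq_apply]
  simp
  nlinarith [sq_le_sq' (by linarith [abs_nonneg ω]) hω, sq_abs ω]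

theorem one_le_norm_lower {w ρ ω : ℝ} (hw : 0 < w) (hω : w ≤ |ω|) :
    1 ≤ ‖(√(ρ ^ 2 + 1) : ℝ) * (Complex.I * ω) / (w - ρ * (Complex.I * ω))‖ := by
  have hα : (w : ℂ) - ρ * (Complex.I * ω) ≠ 0 := fun h => hw.ne' (by
    simpa using congrArg Complex.re h)
  rw [norm_div, one_le_div (norm_pos_iff.2 hα)]
  refine le_of_sq_le_sq ?_ (norm_nonneg _)
  rw [norm_mul, mul_pow, Complex.norm_of_nonneg (Real.sqrt_nonneg _),
    Real.sq_sqrt (by positivity), Complex.sq_norm, Complex.normSq_apply]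
  simp
  nlinarith [sq_le_sq' (by linarith [abs_nonneg ω]) hω, sq_abs ω]

end PFDBT

theorem theorem3p3 {n m p r : ℕ} (hr : r ≤ n) (w : ℝ) (hw : 0 < w) (ρ : ℝ)
    (G : PFDBT.StateSpace n m p) (σ : Fin n → ℝ) (Gr : PFDBT.StateSpace r m p) :
    (PFDBT.IsUpperReduction hr w ρ G σ Gr →
      ∀ ω : ℝ, w ≤ |ω| →
        G.DefinedAt (Complex.I * ω) ∧ Gr.DefinedAt (Complex.I * ω) ∧
        PFDBT.sigmaMax (G.transfer (Complex.I * ω) - Gr.transfer (Complex.I * ω)) ≤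
          2 * √(ρ ^ 2 + w ^ 2) * ∑ i ∈ Finset.univ.filter (fun i : Fin n => r ≤ (i : ℕ)), σ i) ∧
    (PFDBT.IsLowerReduction hr w ρ G σ Gr →
      ∀ ω : ℝ, w ≤ |ω| →
        G.DefinedAt (Complex.I * ω) ∧ Gr.DefinedAt (Complex.I * ω) ∧
        PFDBT.sigmaMax (G.transfer (Complex.I * ω) - Gr.transfer (Complex.I * ω)) ≤
          2 * √((w * ρ) ^ 2 + w ^ 2) * ∑ i ∈ Finset.univ.filter (fun i : Fin n => r ≤ (i : ℕ)), σ i) := by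
  refine ⟨?_, ?_⟩
  · rintro ⟨hH, S, hS, rfl⟩ ω hω
    have hz := PFDBT.one_le_norm_upper (ρ := ρ) hw hω
    set z := (Complex.I * ω + ρ) / (√(ρ ^ 2 + w ^ 2) : ℝ)
    have hzs : (√(ρ ^ 2 + w ^ 2) : ℝ) * z = Complex.I * ω + ρ :=
      mul_div_cancel₀ _ (Complex.ofReal_ne_zero.2 (Real.sqrt_pos.2 (by positivity)).ne')
    obtain ⟨h1, h2⟩ := PFDBT.transfer_eq_upperMap hw ρ G hzs
      (PFDBT.StateSpace.definedAt_of_schurStable hH hz)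
    obtain ⟨h3, h4⟩ := PFDBT.transfer_eq_upperMap hw ρ (PFDBT.upperInv w ρ S) hzs
      (by rw [PFDBT.upperMap_upperInv hw]; exact hS.definedAt hH hz)
    refine ⟨h1, h3, ?_⟩
    rw [h2, h4, PFDBT.upperMap_upperInv hw]
    exact hS.sigmaMax_smul_sub_le hH hz (Real.sqrt_nonneg _)
  · rintro ⟨hN, hH, S, hS, rfl⟩ ω hω
    have hα : (w : ℂ) - ρ * (Complex.I * ω) ≠ 0 := fun h => hw.ne' (by
      simpa using congrArg Complex.re h)
    have hz := PFDBT.one_le_norm_lower (ρ := ρ) hw hω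
    set z := (√(ρ ^ 2 + 1) : ℝ) * (Complex.I * ω) / (w - ρ * (Complex.I * ω))
    have hzs : z * (w - ρ * (Complex.I * ω)) = (√(ρ ^ 2 + 1) : ℝ) * (Complex.I * ω) :=
      div_mul_cancel₀ _ hα
    have hκ : |ρ * (√(ρ ^ 2 + 1))⁻¹| ≤ 1 := by
      have hk : 0 < √(ρ ^ 2 + 1) := Real.sqrt_pos.2 (by positivity)
      rw [← div_eq_mul_inv, abs_div, abs_of_pos hk, div_le_one hk]
      exact Real.abs_le_sqrt (by linarith)
    obtain ⟨hNr, hmap⟩ := PFDBT.lowerMap_lowerInv hw ρ S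
      (PFDBT.isUnit_det_one_add_smul (fun _ hz => hS.definedAt hH hz) hκ)
    obtain ⟨h1, h2⟩ := PFDBT.transfer_eq_lowerMap hw ρ G hN hα hzs
      (PFDBT.StateSpace.definedAt_of_schurStable hH hz)
    obtain ⟨h3, h4⟩ := PFDBT.transfer_eq_lowerMap hw ρ (PFDBT.lowerInv w ρ S) hNr hα hzs
      (by rw [hmap]; exact hS.definedAt hH hz)
    have hc : √((w * ρ) ^ 2 + w ^ 2) = w * √(ρ ^ 2 + 1) := by
      rw [show (w * ρ) ^ 2 + w ^ 2 = w ^ 2 * (ρ ^ 2 + 1) by ring, Real.sqrt_mul (sq_nonneg w),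
        Real.sqrt_sq hw.le]
    refine ⟨h1, h3, ?_⟩
    rw [h2, h4, hmap, hc]
    exact hS.sigmaMax_smul_sub_le hH hz (by positivity)
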